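/- Let $\mathcal N\subset\mathbb C^2=\mathbb C_u\times\mathbb C_v$ be empty or an algebraic curve (the zero locus of a nonconstant polynomial, possibly disconnected), and let $(R,p)$ be a proper Riemann domain over $\mathbb C^2\setminus\mathcal N$: $R$ is a (Hausdorff) complex manifold of dimension $2$ and $p\colon R\to\mathbb C^2\setminus\mathcal N$ is a proper holomorphic map of maximal rank at every point. Let $P,Q\colon R\to\mathbb C$ be holomorphic, $Q\not\equiv 0$, and suppose that $p(Q^{-1}(0))$ is empty or an algebraic curve in $\mathbb C^2\setminus\mathcal N$ (i.e. of the form $C\setminus\mathcal N$ with $C\subset\mathbb C^2$ an algebraic curve). A number $k\in\mathbb C$ is a horizontal flatness point of a curve $Z(u,v)=0$ if $v-k$ divides the polynomial $Z$; let $A$ be the set of all horizontal flatness points of $p(Q^{-1}(0))\cup\mathcal N$. Let $X_0\in R$, $(u_0,v_0)=p(X_0)$, let $\eta$ be the local inverse of $p$ near $(u_0,v_0)$ with $\eta(u_0,v_0)=X_0$, and let $(\mathcal U,u)$ be a holomorphic function element ($\mathcal U\ni v_0$ open and connected, $u$ holomorphic on $\mathcal U$) that represents a germ of solution at $v_0$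 of the Cauchy problem $$u'(v)=\frac{P}{Q}\bigl(\eta(u(v),v)\bigr),\qquad u(v_0)=u_0,$$ where the equation is read as $Q(\eta(u(v),v))\,u'(v)=P(\eta(u(v),v))$ for $v$ near $v_0$ (the same thing wherever $Q\neq0$). Let $\gamma\colon[0,1]\to\mathbb C\setminus A$ be an embedded rectifiable analytic arc from $v_0$ to $v_1$. Suppose that $u$ continues analytically along $\gamma|_{[0,1)}$, i.e. that there is a holomorphic function element $(\mathcal V,\omega)$, $\mathcal V\subset\mathbb C$ open and connected, with $\gamma([0,1))\subset\mathcal V$, $\omega=u$ near $v_0$, and $v_1\in\partial\mathcal V$. Then $\omega$ has a limit $L\in\mathbb P^1=\mathbb C\cup\{\infty\}$ at $v_1$ in the following sense. For $r>0$ let $\mathcal V_r$ be the connected component of $\mathcal V\cap D(v_1,r)$ that contains $\gamma(t)$ for all $t<1$ close to $1$. Then for every neighbourhood $W$ of $L$ in $\mathbb P^1$ there is $r>0$ with $\omega(\mathcal V_r)\subset W$. In particular $\lim_{t\to1^-}\omega(\gamma(t))=L$; and if $\mathcal V\cap D(v_1,r)$ is connected for arbitrarily small $r>0$, then $\lim_{v\to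 v_1,\,v\in\mathcal V}\omega(v)=L$. -/

import Mathlib

open scoped Manifold ContDiff Topology

/-- The zero locus in `ℂ² = ℂ_u × ℂ_v` of a polynomial in two variables; the variable of index `0`
is `u` and the variable of index `1` is `v`. -/
def zeroLocus₂ (Z : MvPolynomial (Fin 2) ℂ) : Set (ℂ × ℂ) :=
  {z | MvPolynomial.eval ![z.1, z.2] Z = 0}

/-- An algebraic curve in `ℂ²`: the zero locus of a nonconstant polynomial. It may be reducible,
singular or disconnected. -/
def IsAlgebraicCurve (S : Set (ℂ × ℂ)) : Prop :=
  ∃ Z : MvPolynomial (Fin 2) ℂ, Z.totalDegree ≠ 0 ∧ S = zeroLocus₂ Z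

/-- `k` is a horizontal flatness point of the polynomial `Z(u, v)` if `v - k` divides `Z`. -/
def IsHorizontalFlatnessPoint (Z : MvPolynomial (Fin 2) ℂ) (k : ℂ) : Prop :=
  (MvPolynomial.X 1 - MvPolynomial.C k) ∣ Z

/-- The set of all horizontal flatness points of the curve `S`, that is, of the polynomials `Z`
such that `S` is the curve `Z = 0`. -/
def horizontalFlatnessPoints (S : Set (ℂ × ℂ)) : Set ℂ :=
  {k | ∃ Z : MvPolynomial (Fin 2) ℂ, S = zeroLocus₂ Z ∧ IsHorizontalFlatnessPoint Z k}

section RiemannDomain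

variable {R : Type*} [TopologicalSpace R] [ChartedSpace (ℂ × ℂ) R]

/-- `(R, p)` is a proper Riemann domain over `ℂ² ∖ N`: the map `p` from the complex surface `R` is
holomorphic, takes its values in `ℂ² ∖ N`, has maximal rank at every point, and is proper as a map
to `ℂ² ∖ N` (it need not be surjective). -/
structure IsProperRiemannDomain (p : R → ℂ × ℂ) (N : Set (ℂ × ℂ)) : Prop where
  holomorphic : ContMDiff 𝓘(ℂ, ℂ × ℂ) 𝓘(ℂ, ℂ × ℂ) ω p
  maximalRank : ∀ x : R, Function.Bijective (mfderiv 𝓘(ℂ, ℂ × ℂ) 𝓘(ℂ, ℂ × ℂ) p x)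
  mapsTo : ∀ x : R, p x ∈ Nᶜ
  proper : IsProperMap (Set.codRestrict p Nᶜ mapsTo)

/-- `u` represents a germ of holomorphic solution at `v₀` of the Cauchy problem
`u' = ((P ∘ η) / (Q ∘ η))(u(v), v)`, `u(v₀) = u₀`. The equation is written as
`Q(η(u(v), v)) u'(v) = P(η(u(v), v))`; this is the same wherever `Q` does not vanish, and no value
is given to the quotient where `Q` vanishes. -/
structure SolvesCauchyProblem (P Q : R → ℂ) (η : ℂ × ℂ → R) (u₀ v₀ : ℂ) (u : ℂ → ℂ) : Prop where
  initial : u v₀ = u₀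
  equation : ∀ᶠ v in 𝓝 v₀, DifferentiableAt ℂ u v ∧ Q (η (u v, v)) * deriv u v = P (η (u v, v))

end RiemannDomain

/-- `(U, f)` is a holomorphic function element: `U` is a connected open set and `f` is holomorphic
on `U`. -/
structure IsFunctionElement (U : Set ℂ) (f : ℂ → ℂ) : Prop where
  isOpen : IsOpen U
  isConnected : IsConnected U
  holomorphic : DifferentiableOn ℂ f U

/-- `γ : [0, 1] → ℂ` is an embedded rectifiable analytic arc from `v₀` to `v₁`. Analyticity is
required on the open interval only. -/
structure IsEmbeddedRectifiableAnalyticArc (γ : ℝ → ℂ) (v₀ v₁ : ℂ) : Prop where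
  continuousOn : ContinuousOn γ (Set.Icc 0 1)
  injOn : Set.InjOn γ (Set.Icc 0 1)
  analytic : AnalyticOnNhd ℝ γ (Set.Ioo 0 1)
  rectifiable : BoundedVariationOn γ (Set.Icc 0 1)
  source : γ 0 = v₀
  target : γ 1 = v₁

/-- For an arc `γ` that runs in `V` up to, but not including, its endpoint `v₁ = γ 1`: the connected
component of `V ∩ D(v₁, r)` that contains `γ(t)` for all `t < 1` close to `1`. -/
def accessRegion (V : Set ℂ) (γ : ℝ → ℂ) (r : ℝ) : Set ℂ :=
  {v | ∃ s ∈ Set.Ico (0 : ℝ) 1, (∀ t ∈ Set.Ico s 1, γ t ∈ V ∩ Metric.ball (γ 1) r) ∧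
    v ∈ connectedComponentIn (V ∩ Metric.ball (γ 1) r) (γ s)}

open Filter Set Metric

/-! Consider the cluster values in `ℙ¹` of the continuation `w` as `v → v₁` inside the access
regions. Since `v₁` is not a horizontal flatness point, the line `v = v₁` meets `p(Q⁻¹(0)) ∪ N` in
finitely many points, so only finitely many finite values `α` are singular.

Suppose some finite cluster value `α` is regular. By properness, finitely many local sections of `p`
cover the fibres near `(α, v₁)`, and `Q` does not vanish on the sheets there. On each sheet the
equation is an ordinary holomorphic one, whose solutions with initial data near `(α, v₁)` live on
discs of a common radius `ρ` (`ContDiffAt.eventually_exists_solution`). Starting from a point of the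
access region closer than `ρ / 2` to `v₁`, the solution `y` is holomorphic at `v₁` and equals `w` on
the connected access region; the limit is `y v₁`
(`IsProperRiemannDomain.exists_tendsto_of_frequently`).

Otherwise every cluster value is `∞` or one of the finitely many singular values. Images of access
regions are connected, so there is only one cluster value, and it is the limit
(`exists_tendsto_of_finite_mapClusterPt`).

The first case needs `w` to satisfy the equation, on some sheet, far from `v₀`. This is
`IsProperRiemannDomain.hasSolutionLift_of_isPreconnected`; the graph of `w` may cross `N`, but only
over isolated points. -/

/-! ### Holomorphic differential equations: existence, uniqueness, uniform radius. -/

/-- One step of the Picard iteration. -/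
theorem exists_picard_step {F : ℂ × ℂ → ℂ} {B : Set (ℂ × ℂ)} {M ρ : ℝ} {a b : ℂ}
    (hF : DifferentiableOn ℂ F B) (hM : ∀ z ∈ B, ‖F z‖ ≤ M)
    {y : ℂ → ℂ} (hy : DifferentiableOn ℂ y (ball b ρ)) (hyB : ∀ v ∈ ball b ρ, (y v, v) ∈ B)
    (hρ : 0 < ρ) :
    ∃ y' : ℂ → ℂ, y' b = a ∧ (∀ v ∈ ball b ρ, HasDerivAt y' (F (y v, v)) v) ∧
      ∀ v ∈ ball b ρ, ‖y' v - a‖ ≤ M * ρ := by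
  have hd : DifferentiableOn ℂ (fun v => F (y v, v)) (ball b ρ) :=
    hF.comp (hy.prodMk differentiableOn_id) hyB
  -- On a disc the integral of the Picard operator is a holomorphic primitive, normalised at the
  -- centre.
  obtain ⟨g, hgb, hg⟩ := hd.isExactOn_ball.with_val_at b a
  refine ⟨g, hgb, hg, fun v hv => ?_⟩
  have h := (convex_ball b ρ).norm_image_sub_le_of_norm_hasDerivWithin_le (f := g) (C := M)
    (fun x hx => (hg x hx).hasDerivWithinAt) (fun x hx => hM _ (hyB x hx))
    (mem_ball_self hρ) hv
  have hM0 : 0 ≤ M := (norm_nonneg _).trans (hM _ (hyB b (mem_ball_self hρ)))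
  rw [hgb] at h
  exact h.trans (mul_le_mul_of_nonneg_left (mem_ball_iff_norm.1 hv).le hM0)

/-- Existence of a holomorphic solution of a holomorphic differential equation on a disc. -/
theorem exists_hasDerivAt_of_lipschitz {F : ℂ × ℂ → ℂ} {B : Set (ℂ × ℂ)} {M ρ : ℝ} {K : NNReal}
    {a b : ℂ} (hF : DifferentiableOn ℂ F B) (hM0 : 0 ≤ M) (hM : ∀ z ∈ B, ‖F z‖ ≤ M)
    (hK : LipschitzOnWith K F B) (hρ : 0 < ρ) (hKρ : K * ρ ≤ 1 / 2)
    (hsub : closedBall a (M * ρ) ×ˢ ball b ρ ⊆ B) :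
    ∃ y : ℂ → ℂ, y b = a ∧ ∀ v ∈ ball b ρ, HasDerivAt y (F (y v, v)) v := by
  have hb : b ∈ ball b ρ := mem_ball_self hρ
  -- The bound `M * ρ` is preserved by a Picard step and keeps the graph inside `B`.
  let S := {y : ℂ → ℂ // y b = a ∧ DifferentiableOn ℂ y (ball b ρ) ∧
    ∀ v ∈ ball b ρ, ‖y v - a‖ ≤ M * ρ}
  have hSB : ∀ y : S, ∀ v ∈ ball b ρ, (y.1 v, v) ∈ B := fun y v hv =>
    hsub ⟨mem_closedBall_iff_norm.2 (y.2.2.2 v hv), hv⟩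
  have step : ∀ y : S, ∃ y' : S, ∀ v ∈ ball b ρ, HasDerivAt y'.1 (F (y.1 v, v)) v := by
    intro y
    obtain ⟨y', h1, h2, h3⟩ := exists_picard_step (a := a) hF hM y.2.2.1 (hSB y) hρ
    exact ⟨⟨y', h1, fun v hv => (h2 v hv).differentiableAt.differentiableWithinAt, h3⟩, h2⟩
  choose Φ hΦ using step
  let y₀ : S := ⟨fun _ => a, rfl, differentiableOn_const _, fun v _ => by
    simpa using mul_nonneg hM0 hρ.le⟩
  let Y : ℕ → S := fun n => Φ^[n] y₀
  have hY : ∀ n, ∀ v ∈ ball b ρ, HasDerivAt (Y (n + 1)).1 (F ((Y n).1 v, v)) v := by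
    intro n
    simp only [Y, Function.iterate_succ_apply']
    exact hΦ _
  -- The first two iterates are both within `M * ρ` of `a`; each further step gains the factor `K *
  -- ρ ≤ 1 / 2`.
  have hdist : ∀ n, ∀ v ∈ ball b ρ,
      dist ((Y n).1 v) ((Y (n + 1)).1 v) ≤ 2 * (M * ρ) * (1 / 2) ^ n := by
    intro n
    induction n with
    | zero =>
      intro v hv
      have h1 := (Y 0).2.2.2 v hv
      have h2 := (Y 1).2.2.2 v hv
      have := dist_triangle_right ((Y 0).1 v) ((Y 1).1 v) a
      simp only [dist_eq_norm] at this ⊢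
      simp only [pow_zero, zero_add]
      linarith
    | succ n ih =>
      intro v hv
      have h := (convex_ball b ρ).norm_image_sub_le_of_norm_hasDerivWithin_le
        (f := fun v => (Y (n + 1)).1 v - (Y (n + 2)).1 v) (C := K * (2 * (M * ρ) * (1 / 2) ^ n))
        (fun x hx => ((hY n x hx).sub (hY (n + 1) x hx)).hasDerivWithinAt)
        (fun x hx => by
          have h1 := hK.dist_le_mul _ (hSB (Y n) x hx) _ (hSB (Y (n + 1)) x hx)
          rw [dist_eq_norm] at h1
          refine h1.trans (mul_le_mul_of_nonneg_left ?_ K.2)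
          rw [Prod.dist_eq]
          simpa using ih x hx) hb hv
      simp only [(Y (n + 1)).2.1, (Y (n + 2)).2.1, sub_self, sub_zero] at h
      rw [dist_eq_norm]
      refine h.trans ?_
      have hv' : ‖v - b‖ ≤ ρ := (mem_ball_iff_norm.1 hv).le
      have hC : 0 ≤ 2 * (M * ρ) * (1 / 2 : ℝ) ^ n := by positivity
      calc K * (2 * (M * ρ) * (1 / 2) ^ n) * ‖v - b‖
          ≤ K * (2 * (M * ρ) * (1 / 2) ^ n) * ρ := by gcongr
        _ = (K * ρ) * (2 * (M * ρ) * (1 / 2) ^ n) := by ring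
        _ ≤ (1 / 2) * (2 * (M * ρ) * (1 / 2) ^ n) := by gcongr
        _ = 2 * (M * ρ) * (1 / 2) ^ (n + 1) := by ring
  have hlim : ∀ v, ∃ l, v ∈ ball b ρ → Tendsto (fun n => (Y n).1 v) atTop (𝓝 l) := by
    intro v
    by_cases hv : v ∈ ball b ρ
    · obtain ⟨l, hl⟩ := cauchySeq_tendsto_of_complete
        (cauchySeq_of_le_geometric _ _ (by norm_num) fun n => hdist n v hv)
      exact ⟨l, fun _ => hl⟩
    · exact ⟨0, fun h => absurd h hv⟩
  choose y hy using hlim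
  have hyd : ∀ n, ∀ v ∈ ball b ρ, dist ((Y n).1 v) (y v) ≤ 4 * (M * ρ) * (1 / 2) ^ n := by
    intro n v hv
    have := dist_le_of_le_geometric_of_tendsto _ _ (by norm_num) (fun n => hdist n v hv) (hy v hv) n
    refine this.trans_eq ?_
    ring
  have hyB : ∀ v ∈ ball b ρ, (y v, v) ∈ B := fun v hv => hsub ⟨by
    refine isClosed_closedBall.mem_of_tendsto (hy v hv) (Eventually.of_forall fun n => ?_)
    exact mem_closedBall_iff_norm.2 ((Y n).2.2.2 v hv), hv⟩
  refine ⟨y, tendsto_nhds_unique (hy b hb) (by simp only [fun n => (Y n).2.1, tendsto_const_nhds]),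
    fun v hv => ?_⟩
  refine hasDerivAt_of_tendstoLocallyUniformlyOn (l := atTop) (f := fun n => (Y (n + 1)).1)
    (f' := fun n v => F ((Y n).1 v, v)) (g' := fun v => F (y v, v)) isOpen_ball ?_
    (Eventually.of_forall hY) (fun x hx => (tendsto_add_atTop_iff_nat 1).2 (hy x hx)) hv
  refine TendstoUniformlyOn.tendstoLocallyUniformlyOn ?_
  rw [tendstoUniformlyOn_iff]
  intro ε hε
  have ht : Tendsto (fun n : ℕ => K * (4 * (M * ρ) * (1 / 2 : ℝ) ^ n)) atTop (𝓝 0) := by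
    have := (tendsto_pow_atTop_nhds_zero_of_lt_one (r := (1 / 2 : ℝ)) (by norm_num)
      (by norm_num)).const_mul (K * (4 * (M * ρ)))
    simpa [mul_assoc] using this
  filter_upwards [ht.eventually_lt_const hε] with n hn x hx
  refine lt_of_le_of_lt ?_ hn
  rw [dist_comm]
  refine (hK.dist_le_mul _ (hSB (Y n) x hx) _ (hyB x hx)).trans
    (mul_le_mul_of_nonneg_left ?_ K.2)
  rw [Prod.dist_eq]
  simpa using hyd n x hx

/-- Local uniqueness for holomorphic differential equations. -/
theorem eventuallyEq_of_hasDerivAt_of_lipschitz {F : ℂ × ℂ → ℂ} {B : Set (ℂ × ℂ)} {K : NNReal}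
    {a b : ℂ} (hB : B ∈ 𝓝 (a, b)) (hK : LipschitzOnWith K F B) {y w : ℂ → ℂ}
    (hyb : y b = a) (hwb : w b = a)
    (hy : ∀ᶠ v in 𝓝 b, HasDerivAt y (F (y v, v)) v)
    (hw : ∀ᶠ v in 𝓝 b, HasDerivAt w (F (w v, v)) v) : w =ᶠ[𝓝 b] y := by
  have hyc : ContinuousAt (fun v => (y v, v)) b :=
    hy.self_of_nhds.continuousAt.prodMk continuousAt_id
  have hwc : ContinuousAt (fun v => (w v, v)) b :=
    hw.self_of_nhds.continuousAt.prodMk continuousAt_id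
  have hyB : ∀ᶠ v in 𝓝 b, (y v, v) ∈ B := hyc (by simpa [hyb] using hB)
  have hwB : ∀ᶠ v in 𝓝 b, (w v, v) ∈ B := hwc (by simpa [hwb] using hB)
  obtain ⟨δ, hδ, hball⟩ := Metric.eventually_nhds_iff_ball.1
    (hy.and (hw.and (hyB.and hwB)))
  obtain ⟨r, hr0, hrδ, hKr⟩ : ∃ r > 0, r < δ ∧ K * r ≤ 1 / 2 := by
    refine ⟨min (δ / 2) (1 / (2 * (K + 1))), by positivity, ?_, ?_⟩
    · exact (min_le_left _ _).trans_lt (by linarith)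
    · calc (K : ℝ) * min (δ / 2) (1 / (2 * (K + 1))) ≤ (K + 1) * (1 / (2 * (K + 1))) := by
            gcongr
            · linarith
            · exact min_le_right _ _
        _ = 1 / 2 := by
            have : (K : ℝ) + 1 ≠ 0 := by positivity
            field_simp
  have hsub : closedBall b r ⊆ ball b δ := closedBall_subset_ball hrδ
  have hb : b ∈ closedBall b r := mem_closedBall_self hr0.le
  have hcont : ContinuousOn (fun v => ‖w v - y v‖) (closedBall b r) := fun v hv => by
    obtain ⟨h1, h2, -⟩ := hball v (hsub hv)
    exact (h2.continuousAt.sub h1.continuousAt).norm.continuousWithinAt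
  -- At a maximum point `m` of the difference, the mean value inequality bounds the maximum by `K *
  -- r ≤ 1 / 2` times itself, so it is zero.
  obtain ⟨m, hm, hmax⟩ := (isCompact_closedBall b r).exists_isMaxOn ⟨b, hb⟩ hcont
  have hle := (convex_closedBall b r).norm_image_sub_le_of_norm_hasDerivWithin_le
    (f := fun v => w v - y v) (C := K * ‖w m - y m‖)
    (fun x hx => ((hball x (hsub hx)).2.1.sub (hball x (hsub hx)).1).hasDerivWithinAt)
    (fun x hx => by
      obtain ⟨-, -, h3, h4⟩ := hball x (hsub hx)
      have h1 := hK.dist_le_mul _ h4 _ h3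
      rw [dist_eq_norm] at h1
      refine h1.trans (mul_le_mul_of_nonneg_left ?_ K.2)
      rw [Prod.dist_eq]
      simpa [dist_eq_norm] using hmax hx) hb hm
  have hm0 : ‖w m - y m‖ ≤ 0 := by
    have h1 : ‖m - b‖ ≤ r := mem_closedBall_iff_norm.1 hm
    simp only [hyb, hwb, sub_self, sub_zero] at hle
    have h2 : K * ‖w m - y m‖ * ‖m - b‖ ≤ K * ‖w m - y m‖ * r := by gcongr
    nlinarith [norm_nonneg (w m - y m)]
  filter_upwards [closedBall_mem_nhds b hr0] with v hv
  have : ‖w v - y v‖ ≤ ‖w m - y m‖ := hmax hv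
  exact sub_eq_zero.1 (norm_le_zero_iff.1 (this.trans hm0))

/-- Solutions of a holomorphic differential equation with initial values near a point exist on a
disc of fixed radius. -/
theorem ContDiffAt.eventually_exists_solution {F : ℂ × ℂ → ℂ} {z₀ : ℂ × ℂ}
    (hF : ContDiffAt ℂ 1 F z₀) :
    ∀ᶠ ρ : ℝ in 𝓝[>] 0, ∀ᶠ z in 𝓝 z₀, ∃ y : ℂ → ℂ, DifferentiableOn ℂ y (ball z.2 ρ) ∧
      ∀ w : ℂ → ℂ, w z.2 = z.1 → (∀ᶠ v in 𝓝 z.2, HasDerivAt w (F (w v, v)) v) →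
        w =ᶠ[𝓝 z.2] y := by
  obtain ⟨K, t, ht, hK⟩ := hF.exists_lipschitzOnWith
  have hd : ∀ᶠ z in 𝓝 z₀, DifferentiableAt ℂ F z :=
    (hF.eventually (by simp)).mono fun z hz => hz.differentiableAt (by simp)
  have hM : ∀ᶠ z in 𝓝 z₀, ‖F z‖ < ‖F z₀‖ + 1 :=
    hF.continuousAt.norm.eventually_lt_const (by linarith)
  obtain ⟨δ, hδ, hball⟩ := Metric.eventually_nhds_iff_ball.1 (hd.and (hM.and ht))
  set M := ‖F z₀‖ + 1 with hMdef
  have hM0 : 0 < M := by positivity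
  have hρ : ∀ᶠ ρ : ℝ in 𝓝[>] 0, 0 < ρ ∧ K * ρ < 1 / 2 ∧ M * ρ < δ / 2 ∧ ρ < δ / 2 := by
    have h1 : Tendsto (fun ρ : ℝ => K * ρ) (𝓝[>] 0) (𝓝 (K * 0)) :=
      ((continuous_const_mul _).tendsto _).mono_left nhdsWithin_le_nhds
    have h2 : Tendsto (fun ρ : ℝ => M * ρ) (𝓝[>] 0) (𝓝 (M * 0)) :=
      ((continuous_const_mul _).tendsto _).mono_left nhdsWithin_le_nhds
    have h3 : Tendsto (fun ρ : ℝ => ρ) (𝓝[>] 0) (𝓝 0) := nhdsWithin_le_nhds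
    filter_upwards [self_mem_nhdsWithin, h1.eventually_lt_const (by simp : (K : ℝ) * 0 < 1 / 2),
      h2.eventually_lt_const (by simpa using hδ : M * 0 < δ / 2),
      h3.eventually_lt_const (by simpa using hδ : 0 < δ / 2)] with ρ a b c d
    exact ⟨a, b, c, d⟩
  filter_upwards [hρ] with ρ ⟨hρ0, hKρ, hMρ, hρδ⟩
  filter_upwards [ball_mem_nhds z₀ (half_pos hδ)] with z hz
  -- The centre `z` uses up `δ / 2`, and the bounds on `M * ρ` and `ρ` leave the other half for the
  -- box.
  have hsub : closedBall z.1 (M * ρ) ×ˢ ball z.2 ρ ⊆ ball z₀ δ := by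
    rintro ⟨x, v⟩ ⟨hx, hv⟩
    rw [mem_ball, Prod.dist_eq, max_lt_iff] at hz
    rw [mem_ball, Prod.dist_eq, max_lt_iff]
    simp only [mem_closedBall, mem_ball] at hx hv
    have h1 := dist_triangle x z.1 z₀.1
    have h2 := dist_triangle v z.2 z₀.2
    constructor <;> simp only <;> linarith
  have hKB : LipschitzOnWith K F (ball z₀ δ) := hK.mono fun z hz => (hball z hz).2.2
  obtain ⟨y, hyb, hy⟩ := exists_hasDerivAt_of_lipschitz (M := M)
    (fun z hz => (hball z hz).1.differentiableWithinAt) hM0.le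
    (fun z hz => (hball z hz).2.1.le) hKB hρ0 hKρ.le hsub
  refine ⟨y, fun v hv => (hy v hv).differentiableAt.differentiableWithinAt, fun w hwz hw => ?_⟩
  have hB : ball z₀ δ ∈ 𝓝 (z.1, z.2) :=
    isOpen_ball.mem_nhds (ball_subset_ball (by linarith) hz)
  exact eventuallyEq_of_hasDerivAt_of_lipschitz hB hKB hyb hwz
    (Metric.eventually_nhds_iff_ball.2 ⟨ρ, hρ0, hy⟩) hw

/-! ### Local sections of the Riemann domain. -/

section LocalSections

variable {R : Type*} [TopologicalSpace R] [ChartedSpace (ℂ × ℂ) R]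

/-- `s` is a holomorphic local inverse of `p` at `x`. -/
structure IsLocalSection (p : R → ℂ × ℂ) (x : R) (s : ℂ × ℂ → R) : Prop where
  apply_eq : s (p x) = x
  right_inv : ∀ᶠ z in 𝓝 (p x), p (s z) = z
  left_inv : ∀ᶠ x' in 𝓝 x, s (p x') = x'
  holomorphic : ∀ᶠ z in 𝓝 (p x), ContMDiffAt 𝓘(ℂ, ℂ × ℂ) 𝓘(ℂ, ℂ × ℂ) ω s z

theorem exists_isLocalSection [IsManifold 𝓘(ℂ, ℂ × ℂ) ω R] {p : R → ℂ × ℂ} {x : R}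
    (hp : ContMDiffAt 𝓘(ℂ, ℂ × ℂ) 𝓘(ℂ, ℂ × ℂ) ω p x)
    (hp' : Function.Bijective (mfderiv 𝓘(ℂ, ℂ × ℂ) 𝓘(ℂ, ℂ × ℂ) p x)) :
    ∃ s, IsLocalSection p x s := by
  set φ := extChartAt 𝓘(ℂ, ℂ × ℂ) x with hφ
  set f : ℂ × ℂ → ℂ × ℂ := p ∘ φ.symm with hf
  have hφx : φ.symm (φ x) = x := extChartAt_to_inv x
  have hfx : f (φ x) = p x := by simp [hf, hφx]
  have hfc : ContDiffAt ℂ ω f (φ x) := by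
    have := (contMDiffAt_iff.1 hp).2
    rw [ModelWithCorners.range_eq_univ, contDiffWithinAt_univ] at this
    exact this
  let D : (ℂ × ℂ) →L[ℂ] (ℂ × ℂ) := mfderiv 𝓘(ℂ, ℂ × ℂ) 𝓘(ℂ, ℂ × ℂ) p x
  have hD : HasFDerivAt f D (φ x) := by
    have h := (hp.mdifferentiableAt (by simp)).hasMFDerivAt.2
    rw [ModelWithCorners.range_eq_univ] at h
    exact hasFDerivWithinAt_univ.1 h
  let L : (ℂ × ℂ) ≃L[ℂ] (ℂ × ℂ) := ContinuousLinearEquiv.ofBijective D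
    (LinearMap.ker_eq_bot.2 hp'.1) (LinearMap.range_eq_top.2 hp'.2)
  have hL : HasFDerivAt f (L : (ℂ × ℂ) →L[ℂ] (ℂ × ℂ)) (φ x) := hD
  have hstrict := hfc.hasStrictFDerivAt' hL (by simp)
  have hgc : ContDiffAt ℂ ω (hfc.localInverse hL (by simp)) (f (φ x)) :=
    hfc.to_localInverse hL (by simp)
  have hgx : hfc.localInverse hL (by simp) (f (φ x)) = φ x :=
    hfc.localInverse_apply_image hL (by simp)
  have hgr : ∀ᶠ y in 𝓝 (f (φ x)), f (hfc.localInverse hL (by simp) y) = y :=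
    hstrict.eventually_right_inverse
  have hgl : ∀ᶠ y in 𝓝 (φ x), hfc.localInverse hL (by simp) (f y) = y :=
    hstrict.eventually_left_inverse
  -- Only these four properties of the inverse are kept, so that `f (φ x)` can be rewritten as `p
  -- x`.
  generalize hfc.localInverse hL (by simp) = g at hgc hgx hgr hgl
  rw [hfx] at hgc hgx hgr
  refine ⟨fun z => φ.symm (g z), ?_, ?_, ?_, ?_⟩
  · simp [hgx, hφx]
  · exact hgr
  · have h1 : ContinuousAt φ x := continuousAt_extChartAt x
    filter_upwards [h1.eventually hgl, extChartAt_source_mem_nhds (I := 𝓘(ℂ, ℂ × ℂ)) x]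
      with x' h2 h3
    have h4 : φ.symm (φ x') = x' := φ.left_inv h3
    have h5 : f (φ x') = p x' := by simp [hf, h4]
    rw [h5] at h2
    simp [h2, h4]
  · have h1 : φ.target ∈ 𝓝 (g (p x)) := by
      rw [hgx]
      exact extChartAt_target_mem_nhds x
    filter_upwards [hgc.eventually (by simp), hgc.continuousAt (eventually_mem_nhds_iff.2 h1)]
      with z h2 h3
    exact ((contMDiffOn_extChartAt_symm x).contMDiffAt h3).comp z h2.contMDiffAt

theorem IsLocalSection.contDiffAt {p : R → ℂ × ℂ} {x : R} {s : ℂ × ℂ → R}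
    (hs : IsLocalSection p x s) {f : R → ℂ} (hf : ContMDiff 𝓘(ℂ, ℂ × ℂ) 𝓘(ℂ, ℂ) ω f) :
    ∀ᶠ z in 𝓝 (p x), ContDiffAt ℂ ω (fun z => f (s z)) z :=
  hs.holomorphic.mono fun z hz => ((hf (s z)).comp z hz).contDiffAt

/-- Near a point `z` of the target every fibre of `p` is covered by finitely many local sections
over a neighbourhood of `z`. -/
theorem IsProperRiemannDomain.exists_finset_sections {p : R → ℂ × ℂ} {N : Set (ℂ × ℂ)}
    (hp : IsProperRiemannDomain p N) (hN : IsClosed N) {s : R → ℂ × ℂ → R}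
    (hs : ∀ x, IsLocalSection p x (s x)) {z : ℂ × ℂ} (hz : z ∉ N) :
    ∃ t : Finset R, (∀ x ∈ t, p x = z) ∧
      ∀ᶠ z' in 𝓝 z, ∀ x', p x' = z' → ∃ x ∈ t, s x z' = x' := by
  let q := codRestrict p Nᶜ hp.mapsTo
  have hq : IsProperMap q := hp.proper
  -- The fibre over `z` is compact, so finitely many of the sets on which `s x` inverts `p` cover a
  -- neighbourhood of it.
  obtain ⟨t, ht, htc⟩ := (hq.isCompact_preimage
    (isCompact_singleton (x := ⟨z, hz⟩))).elim_nhds_subcover_nhdsSet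
    (U := fun x => {x' | s x (p x') = x'}) (fun x _ => (hs x).left_inv)
  refine ⟨t, fun x hx => by simpa [q, Subtype.ext_iff] using ht x hx, ?_⟩
  -- Since `p` is a closed map, that neighbourhood contains all fibres over points near `z`.
  have h := hq.isClosedMap.eventually_nhds_fiber (p := fun x' => ∃ x ∈ t, s x (p x') = x')
    ⟨z, hz⟩ fun x₀ hx₀ => by
      filter_upwards [mem_nhdsSet_iff_forall.1 htc x₀ hx₀] with x' hx'
      simpa using hx'
  have h' : ∀ᶠ y : (Nᶜ : Set (ℂ × ℂ)) in 𝓝 ⟨z, hz⟩,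
      (fun z' => ∀ x', p x' = z' → ∃ x ∈ t, s x z' = x') y := by
    filter_upwards [h] with y hy x' hx'
    have := hy x' (by simp [q, Subtype.ext_iff, hx'])
    rwa [hx'] at this
  rw [← hN.isOpen_compl.nhdsWithin_eq hz]
  exact (eventually_nhds_subtype_iff Nᶜ ⟨z, hz⟩
    (fun z' => ∀ x', p x' = z' → ∃ x ∈ t, s x z' = x')).1 h'

end LocalSections

/-- Polar coordinates. It is needed to pass around the isolated points where the graph of a solution
meets `N`. -/
theorem isPreconnected_ball_diff_center (c : ℂ) (r : ℝ) : IsPreconnected (ball c r \ {c}) := by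
  have h : ball c r \ {c} =
      (fun x : ℝ × ℝ => c + x.1 * Complex.exp (x.2 * Complex.I)) '' (Ioo 0 r ×ˢ univ) := by
    ext z
    simp only [Set.mem_sdiff, mem_ball_iff_norm, mem_singleton_iff, mem_image, mem_prod, mem_Ioo,
      mem_univ, and_true, Prod.exists]
    constructor
    · rintro ⟨h1, h2⟩
      refine ⟨‖z - c‖, (z - c).arg, ⟨norm_pos_iff.2 (sub_ne_zero.2 h2), h1⟩, ?_⟩
      rw [Complex.norm_mul_exp_arg_mul_I]
      ring
    · rintro ⟨a, b, ⟨h1, h2⟩, rfl⟩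
      have : ‖(a : ℂ) * Complex.exp (b * Complex.I)‖ = a := by
        rw [norm_mul, Complex.norm_exp_ofReal_mul_I, mul_one, Complex.norm_of_nonneg h1.le]
      refine ⟨by rwa [add_sub_cancel_left, this], fun h => ?_⟩
      rw [add_eq_left] at h
      rw [h, norm_zero] at this
      exact h1.ne this
  rw [h]
  exact (isPreconnected_Ioo.prod isPreconnected_univ).image _ (by fun_prop)

/-! ### Persistence of the equation under analytic continuation. -/

section SolutionLift

variable {R : Type*} [TopologicalSpace R]

/-- Near `v` the graph of `w` lifts to `R` and `w` solves the differential equation along the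
lift. -/
def HasSolutionLift (p : R → ℂ × ℂ) (P Q : R → ℂ) (w : ℂ → ℂ) (v : ℂ) : Prop :=
  ∃ σ : ℂ → R, ∀ᶠ v' in 𝓝 v, ContinuousAt σ v' ∧ p (σ v') = (w v', v') ∧
    Q (σ v') * deriv w v' = P (σ v')

theorem isOpen_setOf_hasSolutionLift (p : R → ℂ × ℂ) (P Q : R → ℂ) (w : ℂ → ℂ) :
    IsOpen {v | HasSolutionLift p P Q w v} := by
  rw [isOpen_iff_mem_nhds]
  rintro v ⟨σ, hσ⟩
  filter_upwards [hσ.eventually_nhds] with v' hv'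
  exact ⟨σ, hv'⟩

variable [ChartedSpace (ℂ × ℂ) R] {p : R → ℂ × ℂ} {N : Set (ℂ × ℂ)} {P Q : R → ℂ} {s : R → ℂ × ℂ → R}

/-- Near a point of the complement of `N` the lifts of a solution are given by one of finitely many
sections. -/
theorem IsProperRiemannDomain.exists_finset_solution (hp : IsProperRiemannDomain p N)
    (hN : IsClosed N) (hs : ∀ x, IsLocalSection p x (s x)) {z : ℂ × ℂ} (hz : z ∉ N) :
    ∃ t : Finset R, (∀ x ∈ t, p x = z) ∧ ∀ᶠ z' in 𝓝 z, ∀ (w : ℂ → ℂ) (v : ℂ), (w v, v) = z' →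
      ContinuousAt w v → HasSolutionLift p P Q w v →
      ∃ x ∈ t, ∀ᶠ v' in 𝓝 v, Q (s x (w v', v')) * deriv w v' = P (s x (w v', v')) := by
  obtain ⟨t, ht, hcov⟩ := hp.exists_finset_sections hN hs hz
  refine ⟨t, ht, ?_⟩
  have h1 : ∀ᶠ z' in 𝓝 z, ∀ x ∈ t, ContinuousAt (s x) z' ∧ ∀ᶠ z'' in 𝓝 z', p (s x z'') = z'' := by
    rw [Finset.eventually_all]
    intro x hx
    have h2 := (hs x).right_inv.eventually_nhds
    have h3 := (hs x).holomorphic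
    rw [ht x hx] at h2 h3
    filter_upwards [h2, h3] with z' h4 h5
    exact ⟨h5.continuousAt, h4⟩
  filter_upwards [h1, hcov] with z' h2 h3 w v hwv hw ⟨σ, hσ⟩
  obtain ⟨h4, h5, -⟩ := hσ.self_of_nhds
  obtain ⟨x, hx, hxs⟩ := h3 (σ v) (h5.trans hwv)
  refine ⟨x, hx, ?_⟩
  have hg : ContinuousAt (fun v' => (w v', v')) v := hw.prodMk continuousAt_id
  have h6 : Tendsto (fun v' => s x (w v', v')) (𝓝 v) (𝓝 (σ v)) := by
    have h7 : ContinuousAt (s x) (w v, v) := by rw [hwv]; exact (h2 x hx).1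
    have := h7.comp_of_eq hg rfl
    rw [← hxs, ← hwv]
    exact this
  have h8 : ∀ᶠ v' in 𝓝 v, p (s x (w v', v')) = (w v', v') := by
    have h9 := (h2 x hx).2
    rw [← hwv] at h9
    exact hg.eventually h9
  filter_upwards [hσ, h8, h6.eventually (hs (σ v)).left_inv, h4.eventually (hs (σ v)).left_inv]
    with v' ⟨_, h10, h11⟩ h12 h13 h14
  -- Both lifts lie near `σ v`, where `s (σ v)` inverts `p`, and they have the same image under `p`.
  have h15 : s x (w v', v') = σ v' := by rw [← h13, ← h14, h12, h10]
  rw [h15, h11]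

/-- Away from `N` the set of points with a lift is closed: a nearby lift follows one of finitely
many sections defined around `(w v, v)`, and the identity theorem spreads the equation on that
section over a whole disc about `v`. -/
theorem IsProperRiemannDomain.hasSolutionLift_of_frequently (hp : IsProperRiemannDomain p N)
    (hN : IsClosed N) (hs : ∀ x, IsLocalSection p x (s x))
    (hP : ContMDiff 𝓘(ℂ, ℂ × ℂ) 𝓘(ℂ, ℂ) ω P) (hQ : ContMDiff 𝓘(ℂ, ℂ × ℂ) 𝓘(ℂ, ℂ) ω Q)
    {w : ℂ → ℂ} {v : ℂ} (hw : ∀ᶠ v' in 𝓝 v, DifferentiableAt ℂ w v') (hv : (w v, v) ∉ N)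
    (hf : ∃ᶠ v' in 𝓝 v, HasSolutionLift p P Q w v') : HasSolutionLift p P Q w v := by
  obtain ⟨t, ht, hsol⟩ := hp.exists_finset_solution (P := P) (Q := Q) hN hs hv
  have hg : ContinuousAt (fun v' => (w v', v')) v :=
    hw.self_of_nhds.continuousAt.prodMk continuousAt_id
  have hreg : ∀ᶠ z in 𝓝 (w v, v), ∀ x ∈ t, ContDiffAt ℂ ω (fun z => P (s x z)) z ∧
      ContDiffAt ℂ ω (fun z => Q (s x z)) z ∧ ContinuousAt (s x) z ∧ p (s x z) = z := by
    rw [Finset.eventually_all]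
    intro x hx
    have h1 := (hs x).contDiffAt hP
    have h2 := (hs x).contDiffAt hQ
    have h3 := (hs x).holomorphic
    have h4 := (hs x).right_inv
    rw [ht x hx] at h1 h2 h3 h4
    filter_upwards [h1, h2, h3, h4] with z a b c d
    exact ⟨a, b, c.continuousAt, d⟩
  obtain ⟨δ, hδ, hball⟩ := Metric.eventually_nhds_iff_ball.1
    (hw.and ((hg.eventually hsol).and (hg.eventually hreg)))
  obtain ⟨v₂, hl, hv₂⟩ := (hf.and_eventually (ball_mem_nhds v hδ)).exists
  obtain ⟨x, hx, hxe⟩ := (hball v₂ hv₂).2.1 w v₂ rfl (hball v₂ hv₂).1.continuousAt hl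
  have hwd : DifferentiableOn ℂ w (ball v δ) := fun v' hv' =>
    (hball v' hv').1.differentiableWithinAt
  have hgd : ∀ v' ∈ ball v δ, DifferentiableAt ℂ (fun v' => (w v', v')) v' := fun v' hv' =>
    (hball v' hv').1.prodMk differentiableAt_id
  have hL : DifferentiableOn ℂ (fun v' => Q (s x (w v', v')) * deriv w v') (ball v δ) := by
    refine DifferentiableOn.mul (fun v' hv' => ?_) (hwd.deriv isOpen_ball)
    have := ((hball v' hv').2.2 x hx).2.1.differentiableAt (by simp)
    exact (DifferentiableAt.comp (f := fun v' => (w v', v'))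
      (g := fun z => Q (s x z)) v' this (hgd v' hv')).differentiableWithinAt
  have hR : DifferentiableOn ℂ (fun v' => P (s x (w v', v'))) (ball v δ) := fun v' hv' => by
    have := ((hball v' hv').2.2 x hx).1.differentiableAt (by simp)
    exact (DifferentiableAt.comp (f := fun v' => (w v', v'))
      (g := fun z => P (s x z)) v' this (hgd v' hv')).differentiableWithinAt
  have heq := (hL.analyticOnNhd isOpen_ball).eqOn_of_preconnected_of_eventuallyEq
    (hR.analyticOnNhd isOpen_ball) (convex_ball v δ).isPreconnected hv₂ hxe
  refine ⟨fun v' => s x (w v', v'), ?_⟩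
  filter_upwards [ball_mem_nhds v hδ] with v' hv'
  obtain ⟨-, -, h3, h4⟩ := (hball v' hv').2.2 x hx
  exact ⟨h3.comp_of_eq (hgd v' hv').continuousAt rfl, h4, heq hv'⟩

/-- Persistence of the differential equation under analytic continuation. -/
theorem IsProperRiemannDomain.hasSolutionLift_of_isPreconnected (hp : IsProperRiemannDomain p N)
    (hN : IsClosed N) (hs : ∀ x, IsLocalSection p x (s x))
    (hP : ContMDiff 𝓘(ℂ, ℂ × ℂ) 𝓘(ℂ, ℂ) ω P) (hQ : ContMDiff 𝓘(ℂ, ℂ × ℂ) 𝓘(ℂ, ℂ) ω Q)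
    {w : ℂ → ℂ} {V : Set ℂ} (hVo : IsOpen V) (hV : IsPreconnected V)
    (hw : DifferentiableOn ℂ w V)
    (hdisc : ∀ v ∈ V, ∀ᶠ v' in 𝓝[≠] v, (w v', v') ∉ N)
    {v₀ : ℂ} (hv₀ : v₀ ∈ V) (h₀ : HasSolutionLift p P Q w v₀) {v : ℂ} (hv : v ∈ V)
    (hvN : (w v, v) ∉ N) : HasSolutionLift p P Q w v := by
  have hwd : ∀ v ∈ V, ∀ᶠ v' in 𝓝 v, DifferentiableAt ℂ w v' := fun v hv =>
    (hVo.eventually_mem hv).mono fun v' hv' => hw.differentiableAt (hVo.mem_nhds hv')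
  have hopen := isOpen_setOf_hasSolutionLift p P Q w
  -- No lift exists over a point where the graph meets `N`, so the connectedness argument runs on
  -- punctured neighbourhoods.
  have key : V ⊆ {v | ∀ᶠ v' in 𝓝[≠] v, HasSolutionLift p P Q w v'} := by
    refine hV.subset_of_closure_inter_subset ?_ ⟨v₀, hv₀, ?_⟩ ?_
    · rw [isOpen_iff_mem_nhds]
      intro v hv
      filter_upwards [eventually_nhdsWithin_iff.1 hv |>.eventually_nhds] with v' hv'
      by_cases h : v' = v
      · rw [h]; exact hv
      · have : ∀ᶠ v'' in 𝓝 v', v'' ≠ v := isOpen_ne.mem_nhds h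
        refine Eventually.filter_mono nhdsWithin_le_nhds ?_
        filter_upwards [hv', this] with v'' h1 h2
        exact h1 h2
    · exact Eventually.filter_mono nhdsWithin_le_nhds (hopen.mem_nhds h₀)
    · rintro v ⟨hcl, hvV⟩
      obtain ⟨δ, hδ, hball⟩ := Metric.eventually_nhds_iff_ball.1
        ((eventually_nhdsWithin_iff.1 (hdisc v hvV)).and (hVo.eventually_mem hvV))
      -- The graph over this punctured disc avoids `N`, so the points with a lift form an open and
      -- relatively closed subset of it.
      have hsub : ball v δ \ {v} ⊆ {v | HasSolutionLift p P Q w v} := by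
        refine (isPreconnected_ball_diff_center v δ).subset_of_closure_inter_subset hopen ?_ ?_
        · obtain ⟨v₂, hv₂, h2⟩ := mem_closure_iff_nhds.1 hcl _ (ball_mem_nhds v hδ)
          have h3 : ∀ᶠ v' in 𝓝[≠] v₂, v' ∈ ball v δ :=
            Eventually.filter_mono nhdsWithin_le_nhds (isOpen_ball.mem_nhds hv₂)
          have h4 : ∀ᶠ v' in 𝓝[≠] v₂, v' ≠ v := by
            by_cases h : v₂ = v
            · rw [h]; exact self_mem_nhdsWithin
            · exact Eventually.filter_mono nhdsWithin_le_nhds (isOpen_ne.mem_nhds h)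
          replace h2 : ∀ᶠ v' in 𝓝[≠] v₂, HasSolutionLift p P Q w v' := h2
          obtain ⟨v₃, a, b, c⟩ := (h2.and (h3.and h4)).exists
          exact ⟨v₃, ⟨b, c⟩, a⟩
        · rintro v' ⟨h1, h2, h3⟩
          refine hp.hasSolutionLift_of_frequently hN hs hP hQ (hwd v' (hball v' h2).2)
            ((hball v' h2).1 h3) (mem_closure_iff_frequently.1 h1)
      exact eventually_nhdsWithin_iff.2 ((eventually_of_mem (ball_mem_nhds v hδ))
        fun v' h1 h2 => hsub ⟨h1, h2⟩)
  have hkv : ∀ᶠ v' in 𝓝[≠] v, HasSolutionLift p P Q w v' := key hv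
  exact hp.hasSolutionLift_of_frequently hN hs hP hQ (hwd v hv) hvN
    (hkv.frequently.filter_mono nhdsWithin_le_nhds)

end SolutionLift

/-! ### Plane algebraic curves and their horizontal sections. -/

section Curves

theorem DifferentiableOn.eval_mvPolynomial {a b : ℂ → ℂ} {V : Set ℂ} (ha : DifferentiableOn ℂ a V)
    (hb : DifferentiableOn ℂ b V) (Z : MvPolynomial (Fin 2) ℂ) :
    DifferentiableOn ℂ (fun v => MvPolynomial.eval ![a v, b v] Z) V := by
  induction Z using MvPolynomial.induction_on with
  | C c => simp
  | add f g hf hg => simpa using hf.fun_add hg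
  | mul_X f i hf =>
    fin_cases i
    · simpa using hf.fun_mul ha
    · simpa using hf.fun_mul hb

theorem isClosed_zeroLocus₂ (Z : MvPolynomial (Fin 2) ℂ) : IsClosed (zeroLocus₂ Z) := by
  refine isClosed_eq ((MvPolynomial.continuous_eval Z).comp ?_) continuous_const
  refine continuous_pi fun i => ?_
  fin_cases i
  · exact continuous_fst
  · exact continuous_snd

theorem zeroLocus₂_mul (Z Z' : MvPolynomial (Fin 2) ℂ) :
    zeroLocus₂ (Z * Z') = zeroLocus₂ Z ∪ zeroLocus₂ Z' := by
  ext z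
  simp [zeroLocus₂]

theorem zeroLocus₂_one : zeroLocus₂ 1 = ∅ := by
  ext z
  simp [zeroLocus₂]

/-- A line `v = k` that is not contained in a curve meets it in finitely many points. -/
theorem finite_section_of_not_isHorizontalFlatnessPoint {Z : MvPolynomial (Fin 2) ℂ} {k : ℂ}
    (h : ¬ IsHorizontalFlatnessPoint Z k) : {u | (u, k) ∈ zeroLocus₂ Z}.Finite := by
  let φ : MvPolynomial (Fin 2) ℂ →ₐ[ℂ] Polynomial ℂ :=
    MvPolynomial.aeval ![Polynomial.X, Polynomial.C k]
  have hφ : ∀ (Z : MvPolynomial (Fin 2) ℂ) u, (φ Z).eval u = MvPolynomial.eval ![u, k] Z := by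
    intro Z u
    induction Z using MvPolynomial.induction_on with
    | C c => simp [φ]
    | add f g hf hg => simp [hf, hg]
    | mul_X f i hf =>
      rw [map_mul, Polynomial.eval_mul, hf, map_mul]
      congr 1
      fin_cases i <;> simp [φ]
  have hne : φ Z ≠ 0 := by
    intro h0
    apply h
    let I : Ideal (MvPolynomial (Fin 2) ℂ) :=
      Ideal.span {MvPolynomial.X 1 - MvPolynomial.C k}
    let ψ : Polynomial ℂ →ₐ[ℂ] MvPolynomial (Fin 2) ℂ := Polynomial.aeval (MvPolynomial.X 0)
    -- Modulo `v - k`, substituting `k` for `v` changes nothing; hence `φ Z = 0` forces `v - k` to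
    -- divide `Z`.
    have hcomp : ((Ideal.Quotient.mkₐ ℂ I).comp ψ).comp φ = Ideal.Quotient.mkₐ ℂ I := by
      refine MvPolynomial.algHom_ext fun i => ?_
      fin_cases i
      · simp [φ, ψ]
      · simp only [AlgHom.comp_apply, φ, ψ, Ideal.Quotient.mkₐ_eq_mk]
        symm
        rw [Ideal.Quotient.eq, Ideal.mem_span_singleton]
        simp
    have hZ := DFunLike.congr_fun hcomp Z
    simp only [AlgHom.comp_apply, h0, map_zero, Ideal.Quotient.mkₐ_eq_mk] at hZ
    exact Ideal.mem_span_singleton.1 (Ideal.Quotient.eq_zero_iff_mem.1 hZ.symm)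
  refine (Polynomial.finite_setOfPred_isRoot hne).subset fun u hu => ?_
  exact (hφ Z u).trans hu

theorem exists_eq_zeroLocus₂ {N : Set (ℂ × ℂ)}
    (hN : N = ∅ ∨ IsAlgebraicCurve N) : ∃ Z, N = zeroLocus₂ Z := by
  rcases hN with rfl | ⟨Z, -, hZ⟩
  · exact ⟨1, zeroLocus₂_one.symm⟩
  · exact ⟨Z, hZ⟩

/-- The graph of a holomorphic function meets a curve that does not contain it in a discrete set. -/
theorem eventually_notMem_zeroLocus₂ {Z : MvPolynomial (Fin 2) ℂ} {V : Set ℂ} {w : ℂ → ℂ}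
    (hVo : IsOpen V) (hV : IsPreconnected V) (hw : DifferentiableOn ℂ w V) {v₀ : ℂ} (hv₀ : v₀ ∈ V)
    (h₀ : (w v₀, v₀) ∉ zeroLocus₂ Z) :
    ∀ v ∈ V, ∀ᶠ v' in 𝓝[≠] v, (w v', v') ∉ zeroLocus₂ Z := by
  intro v hv
  have han := (hw.eval_mvPolynomial differentiableOn_id Z).analyticOnNhd hVo
  rcases (han v hv).eventually_eq_zero_or_eventually_ne_zero with h | h
  · exact absurd (han.eqOn_zero_of_preconnected_of_eventuallyEq_zero hV hv h hv₀) h₀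
  · exact h

end Curves

/-! ### Access regions and their filter. -/

section AccessRegion

variable {V : Set ℂ} {γ : ℝ → ℂ} {r : ℝ}

theorem accessRegion_subset : accessRegion V γ r ⊆ V ∩ ball (γ 1) r := by
  rintro v ⟨s, -, -, hv⟩
  exact connectedComponentIn_subset _ _ hv

theorem accessRegion_mono {r' : ℝ} (h : r ≤ r') : accessRegion V γ r ⊆ accessRegion V γ r' := by
  have hsub : V ∩ ball (γ 1) r ⊆ V ∩ ball (γ 1) r' :=
    inter_subset_inter_right _ (ball_subset_ball h)
  rintro v ⟨s, hs, hγ, hv⟩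
  exact ⟨s, hs, fun t ht => hsub (hγ t ht), connectedComponentIn_mono _ hsub hv⟩

/-- Tails of the arc are connected, so the component does not depend on the parameter from which the
tail starts. -/
theorem accessRegion_eq (hγ : ContinuousOn γ (Icc 0 1)) {s : ℝ} (hs : s ∈ Ico (0 : ℝ) 1)
    (hsγ : ∀ t ∈ Ico s 1, γ t ∈ V ∩ ball (γ 1) r) :
    accessRegion V γ r = connectedComponentIn (V ∩ ball (γ 1) r) (γ s) := by
  have key : ∀ s₁ s₂ : ℝ, 0 ≤ s₁ → s₁ ≤ s₂ → s₂ < 1 →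
      (∀ t ∈ Ico s₁ 1, γ t ∈ V ∩ ball (γ 1) r) →
      connectedComponentIn (V ∩ ball (γ 1) r) (γ s₁) =
        connectedComponentIn (V ∩ ball (γ 1) r) (γ s₂) := by
    intro s₁ s₂ h0 h12 h1 h
    refine connectedComponentIn_eq ?_
    have hpre : IsPreconnected (γ '' Ico s₁ 1) := isPreconnected_Ico.image _
      (hγ.mono fun t ht => ⟨h0.trans ht.1, ht.2.le⟩)
    exact hpre.subset_connectedComponentIn (mem_image_of_mem _ ⟨le_rfl, h12.trans_lt h1⟩)
      (image_subset_iff.2 h) (mem_image_of_mem _ ⟨h12, h1⟩)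
  refine Subset.antisymm ?_ fun v hv => ⟨s, hs, hsγ, hv⟩
  rintro v ⟨s', hs', hs'γ, hv⟩
  rcases le_total s s' with h | h
  · rwa [key s s' hs.1 h hs'.2 hsγ]
  · rwa [← key s' s hs'.1 h hs.2 hs'γ]

theorem exists_forall_mem_ball (hγ : ContinuousOn γ (Icc 0 1)) (hγV : ∀ t ∈ Ico (0 : ℝ) 1, γ t ∈ V)
    (hr : 0 < r) : ∃ s ∈ Ico (0 : ℝ) 1, ∀ t ∈ Ico s 1, γ t ∈ V ∩ ball (γ 1) r := by
  have h := (hγ 1 (right_mem_Icc.2 zero_le_one)).eventually (ball_mem_nhds _ hr)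
  obtain ⟨δ, hδ, hb⟩ := Metric.eventually_nhds_iff_ball.1 (eventually_nhdsWithin_iff.1 h)
  refine ⟨max 0 (1 - δ / 2), ⟨le_max_left _ _, max_lt zero_lt_one (by linarith)⟩, fun t ht => ?_⟩
  have h0 : 0 ≤ t := (le_max_left _ _).trans ht.1
  have h1 : 1 - δ / 2 ≤ t := (le_max_right _ _).trans ht.1
  have h2 := ht.2
  refine ⟨hγV t ⟨h0, h2⟩, hb t ?_ ⟨h0, h2.le⟩⟩
  rw [mem_ball, Real.dist_eq, abs_lt]
  constructor <;> linarith

theorem eventually_mem_accessRegion (hγ : ContinuousOn γ (Icc 0 1))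
    (hγV : ∀ t ∈ Ico (0 : ℝ) 1, γ t ∈ V) (hr : 0 < r) :
    ∀ᶠ t in 𝓝[<] 1, γ t ∈ accessRegion V γ r := by
  obtain ⟨s, hs, h⟩ := exists_forall_mem_ball hγ hγV hr
  filter_upwards [Ico_mem_nhdsLT hs.2] with t ht
  exact ⟨t, ⟨hs.1.trans ht.1, ht.2⟩, fun t' ht' => h t' ⟨ht.1.trans ht'.1, ht'.2⟩,
    mem_connectedComponentIn (h t ht)⟩

theorem isPreconnected_accessRegion (hγ : ContinuousOn γ (Icc 0 1))
    (hγV : ∀ t ∈ Ico (0 : ℝ) 1, γ t ∈ V) (hr : 0 < r) : IsPreconnected (accessRegion V γ r) := by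
  obtain ⟨s, hs, h⟩ := exists_forall_mem_ball hγ hγV hr
  rw [accessRegion_eq hγ hs h]
  exact isPreconnected_connectedComponentIn

theorem isOpen_accessRegion (hV : IsOpen V) (hγ : ContinuousOn γ (Icc 0 1))
    (hγV : ∀ t ∈ Ico (0 : ℝ) 1, γ t ∈ V) (hr : 0 < r) : IsOpen (accessRegion V γ r) := by
  obtain ⟨s, hs, h⟩ := exists_forall_mem_ball hγ hγV hr
  rw [accessRegion_eq hγ hs h]
  exact (hV.inter isOpen_ball).connectedComponentIn

/-- If `V` has only one access to `γ 1`, then the access region contains a punctured neighbourhood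
of `γ 1` in `V`. -/
theorem inter_ball_subset_accessRegion (hγ : ContinuousOn γ (Icc 0 1))
    (hγV : ∀ t ∈ Ico (0 : ℝ) 1, γ t ∈ V) (hr : 0 < r) (h : IsPreconnected (V ∩ ball (γ 1) r)) :
    V ∩ ball (γ 1) r ⊆ accessRegion V γ r := by
  obtain ⟨s, hs, hsγ⟩ := exists_forall_mem_ball hγ hγV hr
  rw [accessRegion_eq hγ hs hsγ]
  exact h.subset_connectedComponentIn (hsγ s ⟨le_rfl, hs.2⟩) Subset.rfl

/-- The filter of the access regions. -/
def accessFilter (V : Set ℂ) (γ : ℝ → ℂ) : Filter ℂ :=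
  ⨅ r ∈ Ioi (0 : ℝ), 𝓟 (accessRegion V γ r)

theorem hasBasis_accessFilter (V : Set ℂ) (γ : ℝ → ℂ) :
    (accessFilter V γ).HasBasis (fun r : ℝ => r ∈ Ioi 0) (accessRegion V γ) :=
  hasBasis_biInf_principal (fun r hr r' hr' =>
    ⟨min r r', mem_Ioi.2 (lt_min hr hr'), accessRegion_mono (min_le_left _ _),
      accessRegion_mono (min_le_right _ _)⟩) ⟨1, mem_Ioi.2 zero_lt_one⟩

theorem accessFilter_le_nhds : accessFilter V γ ≤ 𝓝 (γ 1) := by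
  refine (hasBasis_accessFilter V γ).le_basis_iff nhds_basis_ball |>.2 fun r hr => ⟨r, hr, ?_⟩
  exact accessRegion_subset.trans inter_subset_right

theorem tendsto_accessFilter (hγ : ContinuousOn γ (Icc 0 1))
    (hγV : ∀ t ∈ Ico (0 : ℝ) 1, γ t ∈ V) : Tendsto γ (𝓝[<] 1) (accessFilter V γ) :=
  (hasBasis_accessFilter V γ).tendsto_right_iff.2 fun _ hr =>
    eventually_mem_accessRegion hγ hγV hr

end AccessRegion

/-! ### Cluster values and the existence of the limit. -/

/-- A map with finitely many cluster values along a filter with connected images converges. -/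
theorem exists_tendsto_of_finite_mapClusterPt {X Y : Type*} [TopologicalSpace Y] [CompactSpace Y]
    [T2Space Y] {l : Filter X} [NeBot l] {f : X → Y} {F : Set Y} (hF : F.Finite)
    (hl : ∀ S ∈ l, ∃ T ∈ l, T ⊆ S ∧ IsPreconnected (f '' T))
    (hcl : ∀ y, MapClusterPt y l f → y ∈ F) : ∃ L, Tendsto f l (𝓝 L) := by
  obtain ⟨L, hL⟩ := exists_clusterPt_of_compactSpace (map f l)
  refine ⟨L, fun W hW => ?_⟩
  -- By compactness `f` eventually enters every neighbourhood of `F`.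
  have ht : Tendsto f l (𝓝ˢ F) := isCompact_univ.tendsto_nhdsSet_of_mapClusterPt
    (by simp) fun y _ hy => hcl y hy
  obtain ⟨O, O', hO, hO', hLO, hFO', hdisj⟩ := SeparatedNhds.of_isCompact_isCompact
    (isCompact_singleton (x := L)) (hF.subset (sdiff_subset (t := {L}))).isCompact
    (disjoint_sdiff_right)
  have hOW : IsOpen (O ∩ interior W) := hO.inter isOpen_interior
  have hLOW : L ∈ O ∩ interior W := ⟨hLO rfl, mem_interior_iff_mem_nhds.2 hW⟩
  have hcov : (O ∩ interior W) ∪ O' ∈ 𝓝ˢ F := by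
    refine (hOW.union hO').mem_nhdsSet.2 fun y hy => ?_
    by_cases h : y = L
    · exact Or.inl (h ▸ hLOW)
    · exact Or.inr (hFO' ⟨hy, h⟩)
  obtain ⟨T, hT, hTS, hpre⟩ := hl _ (ht hcov)
  have hfreq : ∃ᶠ x in l, f x ∈ O ∩ interior W := hL.frequently (hOW.mem_nhds hLOW)
  obtain ⟨x, hx, hxT⟩ := (hfreq.and_eventually hT).exists
  -- The connected image lies in two disjoint open sets and meets the one around `L`, so it stays in
  -- that one.
  have hsub := hpre.subset_left_of_subset_union hOW hO' (hdisj.mono_left inter_subset_left)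
    (image_subset_iff.2 hTS) ⟨f x, mem_image_of_mem _ hxT, hx⟩
  rw [mem_map]
  filter_upwards [hT] with x hx
  exact interior_subset (s := W) (hsub (mem_image_of_mem f hx)).2

section Limits

variable {R : Type*} [TopologicalSpace R] {p : R → ℂ × ℂ} {P Q : R → ℂ}

/-- The lift is `v ↦ η(u(v), v)`; it starts the continuation argument at `v₀`. -/
theorem hasSolutionLift_of_solvesCauchyProblem {u w : ℂ → ℂ} {u₀ v₀ : ℂ} {X₀ : R}
    (hX₀ : p X₀ = (u₀, v₀)) (e : OpenPartialHomeomorph R (ℂ × ℂ)) (he₀ : X₀ ∈ e.source)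
    (he : EqOn e p e.source) (hu : SolvesCauchyProblem P Q e.symm u₀ v₀ u) (hwu : w =ᶠ[𝓝 v₀] u) :
    HasSolutionLift p P Q w v₀ := by
  have hud : ∀ᶠ v in 𝓝 v₀, ContinuousAt (fun v => (u v, v)) v :=
    hu.equation.mono fun v hv => hv.1.continuousAt.prodMk continuousAt_id
  have htgt : e.target ∈ 𝓝 (u v₀, v₀) := by
    rw [hu.initial, ← hX₀, ← he he₀]
    exact e.open_target.mem_nhds (e.map_source he₀)
  refine ⟨fun v => e.symm (u v, v), ?_⟩
  filter_upwards [hu.equation, hud, hwu, hwu.deriv, hud.self_of_nhds.eventually htgt]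
    with v h1 h2 h3 h4 h5
  refine ⟨(e.continuousAt_symm h5).comp_of_eq h2 rfl, ?_, ?_⟩
  · rw [← he (e.map_target h5), e.right_inv h5, h3]
  · rw [h4]
    exact h1.2

variable [ChartedSpace (ℂ × ℂ) R] {N : Set (ℂ × ℂ)} {s : R → ℂ × ℂ → R}

/-- A finite cluster value at which the differential equation is regular is a limit. -/
theorem IsProperRiemannDomain.exists_tendsto_of_frequently (hp : IsProperRiemannDomain p N)
    (hN : IsClosed N) (hs : ∀ x, IsLocalSection p x (s x))
    (hP : ContMDiff 𝓘(ℂ, ℂ × ℂ) 𝓘(ℂ, ℂ) ω P) (hQ : ContMDiff 𝓘(ℂ, ℂ × ℂ) 𝓘(ℂ, ℂ) ω Q)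
    {V : Set ℂ} (hV : IsOpen V) {w : ℂ → ℂ} (hw : DifferentiableOn ℂ w V) {γ : ℝ → ℂ}
    (hγ : ContinuousOn γ (Icc 0 1)) (hγV : ∀ t ∈ Ico (0 : ℝ) 1, γ t ∈ V)
    (hlift : ∀ v ∈ V, (w v, v) ∉ N → HasSolutionLift p P Q w v)
    {α : ℂ} (hαN : (α, γ 1) ∉ N) (hαQ : (α, γ 1) ∉ p '' (Q ⁻¹' {0}))
    (hα : ∀ B ∈ 𝓝 (α, γ 1), ∃ᶠ v in accessFilter V γ, (w v, v) ∈ B) :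
    ∃ L : ℂ, Tendsto w (accessFilter V γ) (𝓝 L) := by
  obtain ⟨t, ht, hsol⟩ := hp.exists_finset_solution (P := P) (Q := Q) hN hs hαN
  have hQt : ∀ x ∈ t, Q (s x (α, γ 1)) ≠ 0 := by
    intro x hx h0
    rw [← ht x hx, (hs x).apply_eq] at h0
    exact hαQ ⟨x, h0, ht x hx⟩
  have hreg : ∀ x ∈ t, ContDiffAt ℂ ω (fun z => P (s x z)) (α, γ 1) ∧
      ContDiffAt ℂ ω (fun z => Q (s x z)) (α, γ 1) := by
    intro x hx
    rw [← ht x hx]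
    exact ⟨((hs x).contDiffAt hP).self_of_nhds, ((hs x).contDiffAt hQ).self_of_nhds⟩
  have hode : ∀ᶠ ρ : ℝ in 𝓝[>] 0, ∀ x ∈ t, ∀ᶠ z : ℂ × ℂ in 𝓝 (α, γ 1),
      ∃ y : ℂ → ℂ, DifferentiableOn ℂ y (ball z.2 ρ) ∧ ∀ w : ℂ → ℂ, w z.2 = z.1 →
        (∀ᶠ v in 𝓝 z.2, HasDerivAt w (P (s x (w v, v)) / Q (s x (w v, v))) v) →
        w =ᶠ[𝓝 z.2] y := by
    rw [Finset.eventually_all]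
    intro x hx
    exact (((hreg x hx).1.div (hreg x hx).2 (hQt x hx)).of_le (by simp)).eventually_exists_solution
  -- One radius serves all the sections and is fixed before `v`, so that `v` can then be taken
  -- within `ρ / 2` of `γ 1`.
  obtain ⟨ρ, hρt, hρ⟩ := (hode.and self_mem_nhdsWithin).exists
  replace hρ : 0 < ρ := hρ
  have hQne : ∀ᶠ z in 𝓝 (α, γ 1), ∀ x ∈ t, ∀ᶠ z' in 𝓝 z, Q (s x z') ≠ 0 := by
    rw [Finset.eventually_all]
    intro x hx
    exact ((hreg x hx).2.continuousAt.eventually_ne (hQt x hx)).eventually_nhds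
  have hA : accessRegion V γ (ρ / 2) ∈ accessFilter V γ :=
    (hasBasis_accessFilter V γ).mem_of_mem (half_pos hρ)
  obtain ⟨v, ⟨hsolv, hodev, hQv, hNv⟩, hvA⟩ := ((hα _ (hsol.and (((Finset.eventually_all t).2
    hρt).and (hQne.and (hN.isOpen_compl.mem_nhds hαN))))).and_eventually hA).exists
  have hvV : v ∈ V := (accessRegion_subset hvA).1
  have hwd : ∀ᶠ v' in 𝓝 v, DifferentiableAt ℂ w v' :=
    (hV.eventually_mem hvV).mono fun v' hv' => hw.differentiableAt (hV.mem_nhds hv')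
  have hwc : ContinuousAt w v := hwd.self_of_nhds.continuousAt
  obtain ⟨x, hx, hxe⟩ := hsolv w v rfl hwc (hlift v hvV hNv)
  obtain ⟨y, hy, hyw⟩ := hodev x hx
  have hg : ContinuousAt (fun v' => (w v', v')) v := hwc.prodMk continuousAt_id
  have hwy : w =ᶠ[𝓝 v] y := by
    refine hyw w rfl ?_
    filter_upwards [hxe, hwd, hg.eventually (hQv x hx)] with v' h1 h2 h3
    have h4 : P (s x (w v', v')) / Q (s x (w v', v')) = deriv w v' := by
      rw [← h1, mul_div_cancel_left₀ _ h3]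
    rw [h4]
    exact h2.hasDerivAt
  have hsub : ball (γ 1) (ρ / 2) ⊆ ball v ρ := by
    refine ball_subset_ball' ?_
    have := (accessRegion_subset hvA).2
    rw [mem_ball, dist_comm] at this
    linarith
  have hopen := isOpen_accessRegion hV hγ hγV (half_pos hρ)
  -- The identity theorem on the connected access region: `w` agrees there with a function
  -- holomorphic at `γ 1`.
  have heq : EqOn w y (accessRegion V γ (ρ / 2)) :=
    ((hw.mono fun v hv => (accessRegion_subset hv).1).analyticOnNhd
      hopen).eqOn_of_preconnected_of_eventuallyEq ((hy.mono fun v hv =>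
        hsub (accessRegion_subset hv).2).analyticOnNhd hopen)
      (isPreconnected_accessRegion hγ hγV (half_pos hρ)) hvA hwy
  have hyc : ContinuousAt y (γ 1) := (hy.differentiableAt (isOpen_ball.mem_nhds
    (hsub (mem_ball_self (half_pos hρ))))).continuousAt
  refine ⟨y (γ 1), Tendsto.congr' ?_ (hyc.tendsto.mono_left accessFilter_le_nhds)⟩
  filter_upwards [hA] with v' hv'
  exact (heq hv').symm

/-- Dichotomy: either some finite cluster value is regular and the local solution gives the limit,
or the cluster values form a finite set and connectedness gives it. -/
theorem IsProperRiemannDomain.exists_tendsto_accessFilter (hp : IsProperRiemannDomain p N)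
    (hN : IsClosed N) (hs : ∀ x, IsLocalSection p x (s x))
    (hP : ContMDiff 𝓘(ℂ, ℂ × ℂ) 𝓘(ℂ, ℂ) ω P) (hQ : ContMDiff 𝓘(ℂ, ℂ × ℂ) 𝓘(ℂ, ℂ) ω Q)
    {V : Set ℂ} (hV : IsOpen V) {w : ℂ → ℂ} (hw : DifferentiableOn ℂ w V) {γ : ℝ → ℂ}
    (hγ : ContinuousOn γ (Icc 0 1)) (hγV : ∀ t ∈ Ico (0 : ℝ) 1, γ t ∈ V)
    (hlift : ∀ v ∈ V, (w v, v) ∉ N → HasSolutionLift p P Q w v)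
    (hfin : {α : ℂ | (α, γ 1) ∈ p '' (Q ⁻¹' {0}) ∪ N}.Finite) :
    ∃ L : OnePoint ℂ, Tendsto (fun v => (w v : OnePoint ℂ)) (accessFilter V γ) (𝓝 L) := by
  by_cases hreg : ∃ α : ℂ, (α, γ 1) ∉ p '' (Q ⁻¹' {0}) ∪ N ∧
      MapClusterPt (α : OnePoint ℂ) (accessFilter V γ) (fun v => (w v : OnePoint ℂ))
  · obtain ⟨α, hα, hcl⟩ := hreg
    rw [mem_union, not_or] at hα
    obtain ⟨L, hL⟩ := hp.exists_tendsto_of_frequently hN hs hP hQ hV hw hγ hγV hlift hα.2 hα.1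
      fun B hB => by
        obtain ⟨B₁, hB₁, B₂, hB₂, hB₁₂⟩ := mem_nhds_prod_iff.1 hB
        have h1 : (↑) '' B₁ ∈ 𝓝 (α : OnePoint ℂ) := by
          rw [OnePoint.nhds_coe_eq]
          exact image_mem_map hB₁
        refine ((hcl.frequently h1).and_eventually (accessFilter_le_nhds hB₂)).mono ?_
        rintro v ⟨⟨b, hb, hbv⟩, hv⟩
        exact hB₁₂ ⟨OnePoint.coe_injective hbv ▸ hb, hv⟩
    exact ⟨L, (OnePoint.continuous_coe.tendsto L).comp hL⟩
  · push Not at hreg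
    have hbasis := hasBasis_accessFilter V γ
    have : NeBot (accessFilter V γ) := (tendsto_accessFilter hγ hγV).neBot
    refine exists_tendsto_of_finite_mapClusterPt
      (F := insert OnePoint.infty ((↑) '' {α : ℂ | (α, γ 1) ∈ p '' (Q ⁻¹' {0}) ∪ N}))
      ((hfin.image _).insert _) (fun S hS => ?_) fun y hy => ?_
    · obtain ⟨r, hr, hrS⟩ := hbasis.mem_iff.1 hS
      refine ⟨_, hbasis.mem_of_mem hr, hrS, (isPreconnected_accessRegion hγ hγV hr).image _ ?_⟩
      exact OnePoint.continuous_coe.comp_continuousOn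
        (hw.continuousOn.mono fun v hv => (accessRegion_subset hv).1)
    · induction y using OnePoint.rec with
      | infty => exact mem_insert _ _
      | coe α =>
        refine mem_insert_of_mem _ (mem_image_of_mem _ ?_)
        by_contra h
        exact hreg α h hy

end Limits

theorem mainTheorem7
    {R : Type*} [TopologicalSpace R] [T2Space R] [ChartedSpace (ℂ × ℂ) R]
    [IsManifold 𝓘(ℂ, ℂ × ℂ) ω R]
    -- the proper Riemann domain over the complement of an algebraic curve, or over `ℂ²`
    (N : Set (ℂ × ℂ)) (hN : N = ∅ ∨ IsAlgebraicCurve N)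
    (p : R → ℂ × ℂ) (hp : IsProperRiemannDomain p N)
    -- the right-hand side
    (P Q : R → ℂ) (hP : ContMDiff 𝓘(ℂ, ℂ × ℂ) 𝓘(ℂ, ℂ) ω P)
    (hQ : ContMDiff 𝓘(ℂ, ℂ × ℂ) 𝓘(ℂ, ℂ) ω Q) (hQ0 : ∃ x, Q x ≠ 0)
    -- `p(Q⁻¹(0))` is empty or an algebraic curve of `ℂ² ∖ N`
    (hpQ : p '' (Q ⁻¹' {0}) = ∅ ∨ ∃ C, IsAlgebraicCurve C ∧ p '' (Q ⁻¹' {0}) = C \ N)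
    -- the Cauchy problem at `v₀`, with `η = e.symm` the local inverse of `p`
    (X₀ : R) (u₀ v₀ : ℂ) (hX₀ : p X₀ = (u₀, v₀))
    (e : OpenPartialHomeomorph R (ℂ × ℂ)) (he₀ : X₀ ∈ e.source) (he : Set.EqOn e p e.source)
    (U : Set ℂ) (u : ℂ → ℂ) (hU : IsFunctionElement U u) (hv₀ : v₀ ∈ U)
    (hu : SolvesCauchyProblem P Q e.symm u₀ v₀ u)
    -- the arc, which avoids the horizontal flatness points
    (v₁ : ℂ) (γ : ℝ → ℂ) (hγ : IsEmbeddedRectifiableAnalyticArc γ v₀ v₁)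
    (hγA : ∀ t ∈ Set.Icc (0 : ℝ) 1, γ t ∉ horizontalFlatnessPoints (p '' (Q ⁻¹' {0}) ∪ N))
    -- the analytic continuation along the arc without its endpoint
    (V : Set ℂ) (w : ℂ → ℂ) (hV : IsFunctionElement V w) (hγV : ∀ t ∈ Set.Ico (0 : ℝ) 1, γ t ∈ V)
    (hwu : w =ᶠ[𝓝 v₀] u) (hv₁ : v₁ ∈ frontier V) :
    ∃ L : OnePoint ℂ,
      -- the limit in `V`, at the access to `v₁` that the arc determines
      (∀ W ∈ 𝓝 L, ∃ r > 0, ∀ v ∈ accessRegion V γ r, (w v : OnePoint ℂ) ∈ W) ∧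
      -- in particular, the limit along the arc
      Filter.Tendsto (fun t => (w (γ t) : OnePoint ℂ)) (𝓝[<] 1) (𝓝 L) ∧
      -- and the limit in all of `V`, if `V` has only one access to `v₁`
      ((∀ ε > 0, ∃ r, 0 < r ∧ r < ε ∧ IsPreconnected (V ∩ Metric.ball v₁ r)) →
        Filter.Tendsto (fun v => (w v : OnePoint ℂ)) (𝓝[V] v₁) (𝓝 L)) := by
  obtain ⟨ZN, hZN⟩ := exists_eq_zeroLocus₂ hN
  have hNc : IsClosed N := hZN ▸ isClosed_zeroLocus₂ ZN
  obtain ⟨ZS, hZS⟩ : ∃ Z, p '' (Q ⁻¹' {0}) ∪ N = zeroLocus₂ Z := by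
    rcases hpQ with h | ⟨C, ⟨Z, -, hZ⟩, hC⟩
    · exact ⟨ZN, by rw [h, empty_union, hZN]⟩
    -- Removing `N` from `C` is undone by the union with `N`, so the product polynomial defines the
    -- whole singular curve.
    · exact ⟨Z * ZN, by rw [hC, sdiff_union_self, hZ, hZN, zeroLocus₂_mul]⟩
  have hγ1 : γ 1 = v₁ := hγ.target
  have hfin : {α : ℂ | (α, γ 1) ∈ p '' (Q ⁻¹' {0}) ∪ N}.Finite := by
    rw [hZS]
    exact finite_section_of_not_isHorizontalFlatnessPoint fun h =>
      hγA 1 (right_mem_Icc.2 zero_le_one) ⟨ZS, hZS, h⟩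
  choose s hs using fun x => exists_isLocalSection (hp.holomorphic x) (hp.maximalRank x)
  have hv₀V : v₀ ∈ V := hγ.source ▸ hγV 0 (left_mem_Ico.2 zero_lt_one)
  have hwv₀ : (w v₀, v₀) ∉ N := by
    rw [hwu.self_of_nhds, hu.initial, ← hX₀]
    exact hp.mapsTo X₀
  have hdisc : ∀ v ∈ V, ∀ᶠ v' in 𝓝[≠] v, (w v', v') ∉ N := by
    rw [hZN] at hwv₀ ⊢
    exact eventually_notMem_zeroLocus₂ hV.isOpen hV.isConnected.isPreconnected hV.holomorphic
      hv₀V hwv₀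
  have hlift : ∀ v ∈ V, (w v, v) ∉ N → HasSolutionLift p P Q w v := fun v hv hvN =>
    hp.hasSolutionLift_of_isPreconnected hNc hs hP hQ hV.isOpen hV.isConnected.isPreconnected
      hV.holomorphic hdisc hv₀V (hasSolutionLift_of_solvesCauchyProblem hX₀ e he₀ he hu hwu) hv hvN
  obtain ⟨L, hL⟩ := hp.exists_tendsto_accessFilter hNc hs hP hQ hV.isOpen hV.holomorphic
    hγ.continuousOn hγV hlift hfin
  have hacc : ∀ W ∈ 𝓝 L, ∃ r > 0, ∀ v ∈ accessRegion V γ r, (w v : OnePoint ℂ) ∈ W :=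
    fun W hW => (hasBasis_accessFilter V γ).eventually_iff.1 (hL hW)
  refine ⟨L, hacc, hL.comp (tendsto_accessFilter hγ.continuousOn hγV), fun h W hW => ?_⟩
  obtain ⟨r, hr, hrW⟩ := hacc W hW
  -- For a radius `r' < r` with connected intersection, all of `V` near `v₁` lies in the access
  -- region.
  obtain ⟨r', hr', hrr', hpre⟩ := h r hr
  rw [← hγ1] at hpre ⊢
  rw [mem_map]
  filter_upwards [inter_mem_nhdsWithin V (ball_mem_nhds _ hr')] with v hv
  exact hrW v (accessRegion_mono hrr'.le
    (inter_ball_subset_accessRegion hγ.continuousOn hγV hr' hpre hv))
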